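/- Let $\mathbb F_q$ be the finite field with $q$ elements, let $F_1\subsetneq F_2\subsetneq\cdots\subsetneq F_\lambda\subseteq\mathbb F_q$ be subfields and let $\mu_1,\dots,\mu_\lambda\ge 1$ be integers. Put $s_0=0$, $s_t=\mu_1+\cdots+\mu_t$ for $1\le t\le\lambda$, and $m=s_\lambda\geq 1$. For $1\le i\le m$ let $t_i$ be the unique integer with $s_{t_i-1}<i\le s_{t_i}$, and put $A_i=F_{t_i}$, $d_i=|A_i|$ and $\mathcal A=A_1\times\cdots\times A_m=F_1^{\mu_1}\times\cdots\times F_\lambda^{\mu_\lambda}\subseteq\mathbb F_q^m$. Let $\mathrm{Aff}(\mathcal A)$ be the set of maps $\sigma:\mathcal A\to\mathcal A$ with $\sigma(\mathcal A)=\mathcal A$ that are restrictions of affine maps $X\mapsto MX+b$ with $M\in\mathrm{GL}(m,\mathbb F_q)$ and $b\in\mathbb F_q^m$. Let $u=\sum_{i=1}^{j}(d_i-1)+\ell$ with $0\le j<m$ and $0<\ell<d_{j+1}-1$, and put $r=t_{j+1}$. For $1\le k\le j+1$ with $d_k\ge d_{j+1}-\ell$ and for $\Omega\subseteq A_k$ with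 $|\Omega|=d_k-(d_{j+1}-\ell)$, put $$h_k^\Omega(X_1,\dots,X_m)=\prod_{\substack{i=1\\ i\ne k}}^{j+1}\bigl(1-X_i^{d_i-1}\bigr)\prod_{\omega\in\Omega}(X_k-\omega),$$ and let $N_q^{(k)}(u,\mathcal A)$ be the set of all functions $\mathcal A\to\mathbb F_q$ (equivalently, vectors in $\mathbb F_q^{|\mathcal A|}$) of the form $P\mapsto\gamma\, h_k^\Omega(\sigma(P))$ with $\gamma\in\mathbb F_q^*$, $\sigma\in\mathrm{Aff}(\mathcal A)$, and $\Omega\subseteq A_k$ with $|\Omega|=d_k-(d_{j+1}-\ell)$. If $1\le k\le j+1$ and $t_k=r$ (so that $d_k=d_{j+1}$), then $$\bigl|N_q^{(k)}(u,\mathcal A)\bigr|=(q-1)\Bigl(\prod_{\substack{i=1\\ i\ne k}}^{j+1}d_i\Bigr)\begin{bmatrix}\mu_r\\ j-s_{r-1}\end{bmatrix}_{d_{j+1}}\begin{bmatrix}s_r-j\\ 1\end{bmatrix}_{d_k}\binom{d_k}{d_{j+1}-\ell},$$ where $\begin{bmatrix}n\\ t\end{bmatrix}_{d}$ is the Gaussian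 binomial coefficient, i.e. the number of $t$-dimensional linear subspaces of $\mathbb F_d^{\,n}$. -/

import Mathlib

open scoped BigOperators

/-!
Coordinates are indexed by `Fin m`, so the coordinate `X_{i+1}` of the usual `1`-based numbering
is `i : Fin m`. In the same way the blocks are indexed by `t : Fin lam`, standing for `F_{t+1}`.
-/

namespace NestedCartesian

section Blocks

/-- `s_t = μ_1 + ⋯ + μ_t`, the total size of the first `t` blocks (so `s_0 = 0`). -/
def blockSum {lam : ℕ} (μ : Fin lam → ℕ) (t : ℕ) : ℕ :=
  ∑ i : Fin lam with i.val < t, μ i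

/-- The coordinate `i` lies in the block `t`. In `1`-based numbering (coordinate `i + 1`,
block `t + 1`) this reads `s_t < i + 1 ≤ s_{t+1}`. -/
def InBlock {lam : ℕ} (μ : Fin lam → ℕ) (t : Fin lam) (i : ℕ) : Prop :=
  blockSum μ t.val ≤ i ∧ i < blockSum μ (t.val + 1)

end Blocks

/-- The Gaussian binomial coefficient `[n, t]_d` with `d = |K|`: the number of `t`-dimensional
linear subspaces of `K ^ n`. -/
noncomputable def gaussBinom (K : Type*) [Field K] (n t : ℕ) : ℕ :=
  Nat.card {W : Submodule K (Fin n → K) // Module.finrank K W = t}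

variable {F : Type*} [Field F] {m : ℕ}

/-- `d_i = |A_i|`. -/
noncomputable def fieldCard (A : Fin m → Subfield F) (i : Fin m) : ℕ :=
  Nat.card (A i)

/-- The Cartesian product `𝒜 = A_1 × ⋯ × A_m ⊆ F ^ m`. -/
def cart (A : Fin m → Subfield F) : Set (Fin m → F) :=
  {P | ∀ i, P i ∈ A i}

/-- The evaluation `f ↦ c_f = (f(P))_{P ∈ 𝒜}`. -/
noncomputable def ev (A : Fin m → Subfield F) (f : MvPolynomial (Fin m) F) : cart A → F :=
  fun P => MvPolynomial.eval P.val f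

/-- The affine group associated to `𝒜`: the maps of `𝒜` onto itself that are restrictions of
affine maps `X ↦ M X + b` with `M ∈ GL(m, F)` and `b ∈ F ^ m`. -/
def affGroup (A : Fin m → Subfield F) : Set (cart A → cart A) :=
  {φ | Function.Surjective φ ∧
    ∃ (M : GL (Fin m) F) (b : Fin m → F),
      ∀ P : cart A, (φ P).val = Matrix.mulVec M.val P.val + b}

/-- `h_k^Ω = ∏_{i ≤ j+1, i ≠ k} (1 - X_i ^ (d_i - 1)) * ∏_{ω ∈ Ω} (X_k - ω)`; here `j : Fin m` is
the coordinate with `1`-based number `j + 1`. -/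
noncomputable def hPoly (A : Fin m → Subfield F) (j k : Fin m) (Ω : Finset F) :
    MvPolynomial (Fin m) F :=
  (∏ i : Fin m with i ≤ j ∧ i ≠ k, (1 - MvPolynomial.X i ^ (fieldCard A i - 1))) *
    ∏ ω ∈ Ω, (MvPolynomial.X k - MvPolynomial.C ω)

/-- `N^{(k,Ω)}`: the words `γ • (h_k^Ω ∘ σ)` on `𝒜`, with `γ ∈ Fˣ` and `σ ∈ Aff(𝒜)`. -/
def orbitWords (A : Fin m → Subfield F) (j k : Fin m) (Ω : Finset F) : Set (cart A → F) :=
  {c | ∃ γ : Fˣ, ∃ σ ∈ affGroup A, c = fun P => (γ : F) * ev A (hPoly A j k Ω) (σ P)}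

/-- `u = ∑_{i=1}^{j} (d_i - 1) + ℓ` with `0 ≤ j < m` and `0 < ℓ ≤ d_{j+1} - 1`. For given `u` with
`1 ≤ u ≤ ∑_{i=1}^{m} (d_i - 1)` there is exactly one such pair `(j, ℓ)`. -/
def IsDecomp (A : Fin m → Subfield F) (u : ℕ) (j : Fin m) (ℓ : ℕ) : Prop :=
  0 < ℓ ∧ ℓ ≤ fieldCard A j - 1 ∧ u = (∑ i : Fin m with i < j, (fieldCard A i - 1)) + ℓ

/-- `N^{(k)}(u, 𝒜)`: the union of the sets `N^{(k,Ω)}` over all `Ω ⊆ A_k` with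
`|Ω| = d_k - (d_{j+1} - ℓ)`, where `j` and `ℓ` are determined by `u`. -/
def words (A : Fin m → Subfield F) (u : ℕ) (k : Fin m) : Set (cart A → F) :=
  {c | ∃ (j : Fin m) (ℓ : ℕ), IsDecomp A u j ℓ ∧
    ∃ Ω : Finset F, (∀ ω ∈ Ω, ω ∈ A k) ∧ Ω.card + (fieldCard A j - ℓ) = fieldCard A k ∧
      c ∈ orbitWords A j k Ω}

end NestedCartesian


/-!
Put `K = A_j`. A nonzero matrix entry of an affine permutation `σ` of `𝒜` from the coordinate `l` to
the coordinate `i` forces `A_l ⊆ A_i`. Hence `σ` permutes the vectors of low coordinates, those with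
`A_i ⊊ K`, and for fixed low coordinates it acts on the coordinates with `A_i = K` by an affine
bijection over `K`; all such bijections occur. The factors of `h_k^Ω` therefore cut out one vector
of low coordinates and a flat of codimension `j - s_{r-1}` in `K ^ μ_r`, on which the word is
`γ * ∏ ω ∈ Ω, (x f - ω)` for some linear form `f` that is not constant on the flat.

Since `|Ω| = ℓ ≤ |K| - 2`, at least two values of `f` are not in `Ω`, so the support of the word
affinely spans the flat and the word determines it. If two forms `f` and `f'` spanned different
lines modulo the equations of the flat, one could find a point where the first takes a value in `Ω`
but the second takes none in `Ω'`, so the word also determines the line of `f`, and, once `f` is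
fixed on that line, the roots `Ω` and the scalar `γ`. Counting low coordinates, equations and
right-hand sides of the flat, lines, root sets and scalars gives the factors of the formula.
-/

namespace NestedCartesian

section FlatWord

open Module Submodule
open scoped LinearAlgebra.Projectivization

variable {K F D : Type*} [Field K] [Field F] [Algebra K F] [AddCommGroup D] [Module K D]

/-- The function `x ↦ γ * ∏ ω ∈ Ω, (x f - ω)` on the flat of all functionals `x` that restrict to
`ξ` on `U`, extended by zero. The ambient affine space is the dual of `D`, so that `U` is the space
of linear equations of the flat and `ξ` their right-hand sides. -/
noncomputable def flatWord (γ : F) (U : Submodule K D) (ξ : Dual K U) (f : D) (Ω : Finset K) :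
    Dual K D → F :=
  {x : Dual K D | x ∘ₗ U.subtype = ξ}.indicator fun x => γ * ∏ ω ∈ Ω, algebraMap K F (x f - ω)

variable (F D) in
/-- The set of all functions `flatWord γ U ξ f Ω` on flats of codimension `a`, with `γ ≠ 0`, with
`x ↦ x f` nonconstant on the flat and with `ℓ` roots `Ω`. -/
def flatWords (a ℓ : ℕ) : Set (Dual K D → F) :=
  {w | ∃ γ ≠ 0, ∃ (U : Submodule K D) (ξ : Dual K U), ∃ f ∉ U, ∃ Ω : Finset K,
    finrank K U = a ∧ Ω.card = ℓ ∧ w = flatWord γ U ξ f Ω}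

section Recovery

variable {γ γ' : F} {U U' : Submodule K D} {ξ : Dual K U} {ξ' : Dual K U'} {f f' : D}
  {Ω Ω' : Finset K}

theorem support_flatWord (hγ : γ ≠ 0) :
    Function.support (flatWord γ U ξ f Ω) = {x | x ∘ₗ U.subtype = ξ ∧ x f ∉ Ω} := by
  ext x
  simp [flatWord, hγ, Finset.prod_eq_zero_iff, sub_eq_zero]

theorem support_flatWord_nonempty (hγ : γ ≠ 0) (hf : f ∉ U) (hΩ : (Ω : Set K)ᶜ.Nonempty) :
    (Function.support (flatWord γ U ξ f Ω)).Nonempty := by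
  obtain ⟨c, hc⟩ := hΩ
  obtain ⟨x, hxU, rfl⟩ := LinearMap.exists_extend_of_notMem ξ hf c
  exact ⟨x, by rw [support_flatWord hγ]; exact ⟨hxU, hc⟩⟩

theorem mem_iff_forall_support_flatWord_apply_eq (hγ : γ ≠ 0) (hf : f ∉ U)
    (hΩ : (Ω : Set K)ᶜ.Nontrivial) {v : D} :
    v ∈ U ↔ ∀ x ∈ Function.support (flatWord γ U ξ f Ω),
      ∀ y ∈ Function.support (flatWord γ U ξ f Ω), x v = y v := by
  simp only [support_flatWord hγ]
  refine ⟨fun hv x hx y hy => LinearMap.congr_fun (hx.1.trans hy.1.symm) ⟨v, hv⟩, fun h => ?_⟩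
  by_contra hv
  obtain ⟨c, hc, c', hc', hne⟩ := hΩ
  obtain ⟨x, hxU, rfl⟩ := LinearMap.exists_extend_of_notMem ξ hf c
  obtain ⟨δ, hδU, hδv⟩ := LinearMap.exists_extend_of_notMem (0 : Dual K U) hv 1
  -- Moving `x` along `δ` changes its value at `v`; one of two non-roots is attained at `f`.
  obtain ⟨t, ht, htf⟩ : ∃ t : K, t ≠ 0 ∧ x f + t * δ f ∉ Ω := by
    by_cases hδf : δ f = 0
    · exact ⟨1, one_ne_zero, by simpa [hδf] using hc⟩
    · exact ⟨(c' - x f) / δ f, div_ne_zero (sub_ne_zero.2 hne.symm) hδf, by simpa [hδf] using hc'⟩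
  have hxy := h x ⟨hxU, hc⟩ (x + t • δ)
    ⟨by rw [LinearMap.add_comp, LinearMap.smul_comp, hδU, smul_zero, add_zero, hxU], htf⟩
  simp [hδv, ht] at hxy

theorem subspace_eq_of_flatWord_eq (hγ : γ ≠ 0) (hγ' : γ' ≠ 0) (hf : f ∉ U) (hf' : f' ∉ U')
    (hΩ : (Ω : Set K)ᶜ.Nontrivial) (hΩ' : (Ω' : Set K)ᶜ.Nontrivial)
    (h : flatWord γ U ξ f Ω = flatWord γ' U' ξ' f' Ω') : U = U' := by
  ext v
  rw [mem_iff_forall_support_flatWord_apply_eq hγ hf hΩ, h,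
    mem_iff_forall_support_flatWord_apply_eq hγ' hf' hΩ']

theorem functional_eq_of_flatWord_eq {ξ' : Dual K U} (hγ : γ ≠ 0) (hγ' : γ' ≠ 0) (hf : f ∉ U)
    (hΩ : (Ω : Set K)ᶜ.Nonempty) (h : flatWord γ U ξ f Ω = flatWord γ' U ξ' f' Ω') : ξ = ξ' := by
  obtain ⟨x, hx⟩ := support_flatWord_nonempty (ξ := ξ) hγ hf hΩ
  have hx' := h ▸ hx
  rw [support_flatWord hγ] at hx
  rw [support_flatWord hγ'] at hx'
  exact hx.1.symm.trans hx'.1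

theorem mkQ_mem_span_of_flatWord_eq (hγ : γ ≠ 0) (hγ' : γ' ≠ 0) (hf : f ∉ U) (hΩ : Ω.Nonempty)
    (hΩ' : (Ω' : Set K)ᶜ.Nonempty) (h : flatWord γ U ξ f Ω = flatWord γ' U ξ f' Ω') :
    U.mkQ f' ∈ span K {U.mkQ f} := by
  by_contra hf'
  obtain ⟨ω, hω⟩ := hΩ
  obtain ⟨c, hc⟩ := hΩ'
  obtain ⟨x, hxU, rfl⟩ := LinearMap.exists_extend_of_notMem ξ hf ω
  obtain ⟨δ, hδf, hδf'⟩ := LinearMap.exists_extend_of_notMem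
    (0 : Dual K (span K {U.mkQ f})) hf' (c - x f')
  replace hδf : δ (U.mkQ f) = 0 := LinearMap.congr_fun hδf ⟨_, mem_span_singleton_self _⟩
  have hδU : (δ ∘ₗ U.mkQ) ∘ₗ U.subtype = 0 :=
    LinearMap.ext fun v => by simp [(Quotient.mk_eq_zero U).2 v.2]
  have hmem : x + δ ∘ₗ U.mkQ ∈ Function.support (flatWord γ' U ξ f' Ω') := by
    rw [support_flatWord hγ']
    refine ⟨by rw [LinearMap.add_comp, hδU, add_zero, hxU], ?_⟩
    rw [LinearMap.add_apply, LinearMap.comp_apply, hδf', add_sub_cancel]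
    exact hc
  rw [← h, support_flatWord hγ] at hmem
  refine hmem.2 ?_
  rwa [LinearMap.add_apply, LinearMap.comp_apply, hδf, add_zero]

theorem roots_eq_of_flatWord_eq (hγ : γ ≠ 0) (hγ' : γ' ≠ 0) (hf : f ∉ U)
    (h : flatWord γ U ξ f Ω = flatWord γ' U ξ f Ω') : Ω = Ω' := by
  ext c
  obtain ⟨x, hxU, rfl⟩ := LinearMap.exists_extend_of_notMem ξ hf c
  have hsupp := congrArg (x ∈ Function.support ·) h
  exact not_iff_not.1 (by simpa [support_flatWord hγ, support_flatWord hγ', hxU] using hsupp)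

theorem scalar_eq_of_flatWord_eq (hγ : γ ≠ 0) (hf : f ∉ U) (hΩ : (Ω : Set K)ᶜ.Nonempty)
    (h : flatWord γ U ξ f Ω = flatWord γ' U ξ f Ω) : γ = γ' := by
  obtain ⟨x, hx⟩ := support_flatWord_nonempty (ξ := ξ) hγ hf hΩ
  have hxU : x ∘ₗ U.subtype = ξ := by
    rw [support_flatWord hγ] at hx
    exact hx.1
  have hx' := congrFun h x
  rw [Function.mem_support] at hx
  simp only [flatWord, Set.indicator_of_mem (show x ∈ {x | x ∘ₗ U.subtype = ξ} from hxU)] at hx hx'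
  exact mul_right_cancel₀ (right_ne_zero_of_mul hx) hx'

end Recovery

theorem exists_flatWord_eq_of_mkQ_eq_smul (γ : F) {U : Submodule K D} (ξ : Dual K U) {f g : D}
    (Ω : Finset K) {k : K} (hk : k ≠ 0) (hg : U.mkQ g = k • U.mkQ f) :
    ∃ Ω' : Finset K, Ω'.card = Ω.card ∧
      flatWord γ U ξ g Ω = flatWord (γ * algebraMap K F k ^ Ω.card) U ξ f Ω' := by
  have hmem : g - k • f ∈ U := by
    rw [← ker_mkQ U, LinearMap.mem_ker, map_sub, map_smul, hg, sub_self]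
  let e : K ≃ K := (Equiv.subRight (ξ ⟨_, hmem⟩)).trans (Equiv.mulLeft₀ k⁻¹ (inv_ne_zero hk))
  refine ⟨Ω.map e.toEmbedding, Finset.card_map _, Set.indicator_congr fun x hx => ?_⟩
  have hxg : x g = k * x f + ξ ⟨_, hmem⟩ := by
    have hval : x (g - k • f) = ξ ⟨_, hmem⟩ := LinearMap.congr_fun hx ⟨_, hmem⟩
    rw [← hval, map_sub, map_smul, smul_eq_mul, add_sub_cancel]
  have hroot : ∀ ω, x g - ω = k * (x f - e ω) := fun ω => by
    rw [hxg, show e ω = k⁻¹ * (ω - ξ ⟨_, hmem⟩) from rfl]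
    field_simp
    ring
  simp only [Finset.prod_map, Equiv.coe_toEmbedding, hroot, map_mul, Finset.prod_mul_distrib,
    Finset.prod_const, mul_assoc]

/-- A vector outside `U` spanning the given line of the quotient by `U`. -/
noncomputable def lineRep {U : Submodule K D} (L : ℙ K (D ⧸ U)) : D :=
  Quotient.out L.rep

theorem mkQ_lineRep {U : Submodule K D} (L : ℙ K (D ⧸ U)) : U.mkQ (lineRep L) = L.rep :=
  Submodule.Quotient.mk_out L.rep

theorem lineRep_notMem {U : Submodule K D} (L : ℙ K (D ⧸ U)) : lineRep L ∉ U := fun h =>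
  L.rep_nonzero (by rw [← mkQ_lineRep, mkQ_apply, (Quotient.mk_eq_zero U).2 h])

variable (K F D) in
/-- Parameters describing each element of `flatWords F D a ℓ`, exactly once if `0 < ℓ ≤ |K| - 2`:
`f` matters only up to the scalars and translations that are absorbed by `γ` and `Ω`, that is,
through the line it spans modulo `U`. -/
abbrev FlatParam (a ℓ : ℕ) :=
  Σ U : {U : Submodule K D // finrank K U = a},
    Dual K U.1 × ℙ K (D ⧸ U.1) × Fˣ × Set.powersetCard K ℓ

/-- The element of `flatWords F D a ℓ` with the given parameters. -/
noncomputable def FlatParam.word {a ℓ : ℕ} : FlatParam K F D a ℓ → Dual K D → F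
  | ⟨U, ξ, L, γ, Ω⟩ => flatWord γ U.1 ξ (lineRep L) Ω.1

theorem FlatParam.word_injective {a ℓ : ℕ} (hℓ : 0 < ℓ)
    (hroots : ∀ Ω : Finset K, Ω.card = ℓ → (Ω : Set K)ᶜ.Nontrivial) :
    Function.Injective (FlatParam.word : FlatParam K F D a ℓ → Dual K D → F) := by
  rintro ⟨⟨U, hU⟩, ξ, L, γ, ⟨Ω, hΩ⟩⟩ ⟨⟨U', hU'⟩, ξ', L', γ', ⟨Ω', hΩ'⟩⟩ h
  simp only [FlatParam.word] at h
  have hc := hroots Ω hΩ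
  have hc' := hroots Ω' hΩ'
  obtain rfl : U = U' := subspace_eq_of_flatWord_eq γ.ne_zero γ'.ne_zero
    (lineRep_notMem L) (lineRep_notMem L') hc hc' h
  obtain rfl : ξ = ξ' :=
    functional_eq_of_flatWord_eq γ.ne_zero γ'.ne_zero (lineRep_notMem L) hc.nonempty h
  obtain rfl : L = L' := by
    have hmem := mkQ_mem_span_of_flatWord_eq γ.ne_zero γ'.ne_zero (lineRep_notMem L)
      (Finset.card_pos.1 (hℓ.trans_eq hΩ.symm)) hc'.nonempty h
    rw [mkQ_lineRep, mkQ_lineRep, mem_span_singleton] at hmem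
    rw [← L.mk_rep, ← L'.mk_rep, eq_comm, Projectivization.mk_eq_mk_iff']
    exact hmem
  obtain rfl : Ω = Ω' := roots_eq_of_flatWord_eq γ.ne_zero γ'.ne_zero (lineRep_notMem L) h
  obtain rfl : γ = γ' :=
    Units.ext (scalar_eq_of_flatWord_eq γ.ne_zero (lineRep_notMem L) hc.nonempty h)
  rfl

theorem FlatParam.range_word {a ℓ : ℕ} :
    Set.range (FlatParam.word : FlatParam K F D a ℓ → Dual K D → F) = flatWords F D a ℓ := by
  ext w
  constructor
  · rintro ⟨⟨⟨U, hU⟩, ξ, L, γ, ⟨Ω, hΩ⟩⟩, rfl⟩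
    exact ⟨γ, γ.ne_zero, U, ξ, _, lineRep_notMem L, Ω, hU, hΩ, rfl⟩
  · rintro ⟨γ, hγ, U, ξ, f, hf, Ω, hU, hΩ, rfl⟩
    have hf0 : U.mkQ f ≠ 0 := fun h => hf ((Quotient.mk_eq_zero U).1 h)
    obtain ⟨k, hk⟩ := Projectivization.exists_smul_eq_mk_rep K (U.mkQ f) hf0
    rw [← mkQ_lineRep, Units.smul_def] at hk
    obtain ⟨Ω', hΩ', hw⟩ := exists_flatWord_eq_of_mkQ_eq_smul γ ξ Ω (inv_ne_zero k.ne_zero)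
      (eq_inv_smul_iff₀ k.ne_zero |>.2 hk)
    have hγ' : γ * algebraMap K F (k : K)⁻¹ ^ Ω.card ≠ 0 :=
      mul_ne_zero hγ (pow_ne_zero _ (by simp))
    exact ⟨⟨⟨U, hU⟩, ξ, _, Units.mk0 _ hγ', ⟨Ω', hΩ'.trans hΩ⟩⟩, hw.symm⟩

theorem natCard_subspaces_eq_gaussBinom [FiniteDimensional K D] (t : ℕ) :
    Nat.card {W : Submodule K D // finrank K W = t} = gaussBinom K (finrank K D) t := by
  have e : D ≃ₗ[K] (Fin (finrank K D) → K) := LinearEquiv.ofFinrankEq _ _ (by simp)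
  refine Nat.card_congr ((orderIsoMapComap e).toEquiv.subtypeEquiv fun W => ?_)
  rw [← LinearEquiv.finrank_map_eq e W]
  rfl

theorem natCard_projectivization_eq_gaussBinom [FiniteDimensional K D] :
    Nat.card (ℙ K D) = gaussBinom K (finrank K D) 1 := by
  rw [Nat.card_congr (Projectivization.equivSubmodule K D), natCard_subspaces_eq_gaussBinom]

theorem zero_notMem_flatWords {a ℓ : ℕ}
    (hroots : ∀ Ω : Finset K, Ω.card = ℓ → (Ω : Set K)ᶜ.Nonempty) :
    (0 : Dual K D → F) ∉ flatWords F D a ℓ := by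
  rintro ⟨γ, hγ, U, ξ, f, hf, Ω, -, hΩ, h⟩
  have hsupp := support_flatWord_nonempty (ξ := ξ) hγ hf (hroots Ω hΩ)
  simp [← h] at hsupp

theorem compl_nontrivial_of_card_add_two_le {α : Type*} [Finite α] {s : Finset α}
    (hs : s.card + 2 ≤ Nat.card α) : (s : Set α)ᶜ.Nontrivial := by
  rw [← Set.one_lt_ncard_iff_nontrivial, Set.ncard_compl, Set.ncard_coe_finset]
  omega

theorem ncard_flatWords [Finite F] [FiniteDimensional K D] {a ℓ : ℕ} (hℓ : 0 < ℓ)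
    (hℓ' : ℓ + 2 ≤ Nat.card K) :
    (flatWords F D a ℓ : Set (Dual K D → F)).ncard =
      (Nat.card F - 1) * Nat.card K ^ a * gaussBinom K (finrank K D) a *
        gaussBinom K (finrank K D - a) 1 * (Nat.card K).choose ℓ := by
  have : Finite K := Finite.of_injective _ (algebraMap K F).injective
  have : Finite D := Module.finite_of_finite K
  have : Finite (Submodule K D) := Finite.of_injective _ SetLike.coe_injective
  have := Fintype.ofFinite {U : Submodule K D // finrank K U = a}
  have hparam : ∀ U : {U : Submodule K D // finrank K U = a},
      Nat.card (Dual K U.1 × ℙ K (D ⧸ U.1) × Fˣ × Set.powersetCard K ℓ) =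
        Nat.card K ^ a * (gaussBinom K (finrank K D - a) 1 *
          ((Nat.card F - 1) * (Nat.card K).choose ℓ)) := by
    rintro ⟨U, hU⟩
    rw [Nat.card_prod, Nat.card_prod, Nat.card_prod, Nat.card_units, Set.powersetCard.card,
      natCard_projectivization_eq_gaussBinom, Module.natCard_eq_pow_finrank (K := K),
      Subspace.dual_finrank_eq, Submodule.finrank_quotient, hU]
  have hfin : ∀ U : {U : Submodule K D // finrank K U = a},
      Finite (Dual K U.1 × ℙ K (D ⧸ U.1) × Fˣ × Set.powersetCard K ℓ) := fun U => by
    have : Finite (Dual K U.1) := Module.finite_of_finite K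
    have : Finite (D ⧸ U.1) := Finite.of_surjective _ U.1.mkQ_surjective
    infer_instance
  rw [← FlatParam.range_word, Set.ncard_range_of_injective (FlatParam.word_injective hℓ fun Ω hΩ =>
      compl_nontrivial_of_card_add_two_le (hΩ ▸ hℓ')),
    Nat.card_sigma, Finset.sum_congr rfl fun U _ => hparam U, Finset.sum_const, Finset.card_univ,
    ← Nat.card_eq_fintype_card, natCard_subspaces_eq_gaussBinom, smul_eq_mul]
  ring

end FlatWord

section LinearAlgebra

open Module Submodule

theorem comp_subtype_span_eq_iff {R M N : Type*} [Semiring R] [AddCommMonoid M] [Module R M]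
    [AddCommMonoid N] [Module R N] {s : Set M} {x y : M →ₗ[R] N} :
    x ∘ₗ (span R s).subtype = y ∘ₗ (span R s).subtype ↔ Set.EqOn x y s := by
  rw [LinearMap.ext_iff, Subtype.forall]
  exact LinearMap.eqOn_span_iff

theorem linearIndependent_of_forall_exists_dual {R M ι : Type*} [CommRing R] [AddCommGroup M]
    [Module R M] [Finite ι] {φ : ι → M} (h : ∀ t : ι → R, ∃ x : Dual R M, ∀ i, x (φ i) = t i) :
    LinearIndependent R φ := by
  classical
  have := Fintype.ofFinite ι
  refine Fintype.linearIndependent_iff.2 fun g hg i => ?_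
  obtain ⟨x, hx⟩ := h (Pi.single i 1)
  simpa [hx, Pi.single_apply] using congrArg x hg

variable {K D ι : Type*} [Field K] [AddCommGroup D] [Module K D]

theorem exists_basis_eqOn [FiniteDimensional K D] (b : Basis ι K D) {S : Set ι} {φ : ι → D}
    (hφ : LinearIndepOn K φ S) : ∃ b' : Basis ι K D, Set.EqOn b' φ S := by
  have hb : LinearIndependent K fun i : S => b i := b.linearIndependent.comp _ Subtype.val_injective
  replace hφ : LinearIndependent K fun i : S => φ i := hφ
  obtain ⟨g, hg⟩ := exists_linearEquiv_restrict_eq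
    (hb.linearCombinationEquiv.symm.trans hφ.linearCombinationEquiv)
  refine ⟨b.map g, fun i hi => ?_⟩
  have hgi := hg (hb.linearCombinationEquiv (Finsupp.single ⟨i, hi⟩ 1))
  simpa using hgi.symm

theorem exists_basis_span_image_eq [FiniteDimensional K D] (b : Basis ι K D) {S : Set ι} {i : ι}
    (hi : i ∉ S) {U : Submodule K D} (hU : finrank K U = S.ncard) {f : D} (hf : f ∉ U) :
    ∃ b' : Basis ι K D, span K (b' '' S) = U ∧ b' i = f := by
  classical
  have : Finite ι := Module.Finite.finite_basis b
  have := Fintype.ofFinite S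
  let c : Basis S K U := (finBasisOfFinrankEq K U hU).reindex
    (Fintype.equivFinOfCardEq (by rw [← Nat.card_eq_fintype_card, Nat.card_coe_set_eq])).symm
  let φ : ι → D := fun l => if h : l ∈ S then c ⟨l, h⟩ else f
  have hφS : ∀ l : S, φ l = c l := fun l => dif_pos l.2
  have hφi : φ i = f := dif_neg hi
  have hspan : span K (φ '' S) = U := by
    rw [Set.image_eq_range]
    simp only [hφS]
    rw [show (fun l => (c l : D)) = U.subtype ∘ c from rfl, Set.range_comp, span_image, c.span_eq,
      Submodule.map_top, range_subtype]
  have hindep : LinearIndepOn K φ S := by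
    rw [LinearIndepOn]
    simp only [hφS]
    exact c.linearIndependent.map' U.subtype U.ker_subtype
  obtain ⟨b', hb'⟩ := exists_basis_eqOn b
    ((linearIndepOn_insert hi).2 ⟨hindep, by rwa [hspan, hφi]⟩)
  exact ⟨b', by rw [(hb'.mono (Set.subset_insert i S)).image_eq, hspan],
    (hb' (Set.mem_insert i S)).trans hφi⟩

end LinearAlgebra

section Gluing

variable {α C X F : Type*} [Zero F] {p : α → C} {q : α → X}

theorem injOn_indicator_preimage (hpq : Function.Surjective fun a => (p a, q a))
    {G : Set (X → F)} (hG : 0 ∉ G) :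
    Set.InjOn (Function.uncurry fun (c : C) (g : X → F) => (p ⁻¹' {c}).indicator (g ∘ q))
      (Set.univ ×ˢ G) := by
  rintro ⟨c, g⟩ ⟨-, hg⟩ ⟨c', g'⟩ - h
  obtain rfl : c = c' := by
    obtain ⟨x, hx⟩ := Function.ne_iff.1 (ne_of_mem_of_not_mem hg hG)
    obtain ⟨a, ha⟩ := hpq (c, x)
    obtain ⟨rfl, rfl⟩ := Prod.mk.inj ha
    by_contra hne
    exact hx (by simpa [hne] using congrFun h a)
  refine Prod.ext rfl (funext fun x => ?_)
  obtain ⟨a, ha⟩ := hpq (c, x)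
  obtain ⟨rfl, rfl⟩ := Prod.mk.inj ha
  simpa using congrFun h a

end Gluing

section Evaluation

variable {F : Type*} [Field F]

theorem one_sub_pow_natCard_sub_one (K : Subfield F) [Finite K] {x : F} [Decidable (x = 0)]
    (hx : x ∈ K) : 1 - x ^ (Nat.card K - 1) = if x = 0 then 1 else 0 := by
  have := Fintype.ofFinite K
  split_ifs with h
  · rw [h, zero_pow (Nat.sub_pos_of_lt Finite.one_lt_card).ne', sub_zero]
  · have hpow := FiniteField.pow_card_sub_one_eq_one (⟨x, hx⟩ : K)
      (by simpa [Subtype.ext_iff] using h)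
    rw [← Nat.card_eq_fintype_card] at hpow
    rw [show x ^ (Nat.card K - 1) = 1 from congrArg Subtype.val hpow, sub_self]

open Classical in
theorem ev_hPoly {m : ℕ} (A : Fin m → Subfield F) [∀ i, Finite (A i)] (j k : Fin m) (Ω : Finset F)
    (Q : cart A) :
    ev A (hPoly A j k Ω) Q =
      if ∀ i, i ≤ j → i ≠ k → Q.1 i = 0 then ∏ ω ∈ Ω, (Q.1 k - ω) else 0 := by
  simp only [ev, hPoly, fieldCard, map_mul, map_prod, map_sub, map_one, map_pow,
    MvPolynomial.eval_X, MvPolynomial.eval_C]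
  rw [Finset.prod_congr rfl fun i _ => one_sub_pow_natCard_sub_one (A i) (Q.2 i),
    Finset.prod_ite_zero]
  simp

end Evaluation

section Coordinates

open Module

variable {F : Type*} [Field F] {m : ℕ} {A : Fin m → Subfield F} (K : Subfield F)

/-- The coordinates with values in subfields strictly smaller than `K`. -/
abbrev LowIndex (A : Fin m → Subfield F) (K : Subfield F) := {i // A i < K}

/-- The coordinates with values in exactly `K`. -/
abbrev BlockIndex (A : Fin m → Subfield F) (K : Subfield F) := {i // A i = K}

/-- The coordinates of a point that lie in subfields strictly smaller than `K`. -/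
def lowPart (P : cart A) (i : LowIndex A K) : A i := ⟨P.1 i, P.2 i⟩

/-- The coordinates of a point that lie in the block of `K`. -/
def blockPart (P : cart A) (i : BlockIndex A K) : K := ⟨P.1 i, i.2.le (P.2 i)⟩

/-- The coordinates of a point in the block of `K`, regarded as a functional on the space of linear
forms, so that the equations cutting out a flat of the block are vectors. -/
noncomputable def blockDual (P : cart A) : Dual K (BlockIndex A K → K) :=
  (Pi.basisFun K (BlockIndex A K)).constr K (blockPart K P)

theorem coe_blockDual_apply [Fintype (BlockIndex A K)] (P : cart A) (v : BlockIndex A K → K) :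
    (blockDual K P v : F) = ∑ i, (v i : F) * P.1 i := by
  simp [blockDual, Basis.constr_apply_fintype, blockPart]

theorem exists_lowPart_eq_and_blockPart_eq (c : ∀ i : LowIndex A K, A i)
    (x : BlockIndex A K → K) : ∃ P : cart A, lowPart K P = c ∧ blockPart K P = x := by
  classical
  let P : Fin m → F := fun i =>
    if h : A i < K then c ⟨i, h⟩ else if h' : A i = K then x ⟨i, h'⟩ else 0
  have hP : P ∈ cart A := fun i => by
    dsimp only [P]
    split_ifs with h h'
    · exact (c ⟨i, h⟩).2
    · exact h'.ge (x ⟨i, h'⟩).2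
    · exact zero_mem _
  exact ⟨⟨P, hP⟩, funext fun i => Subtype.ext (dif_pos i.2),
    funext fun i => Subtype.ext ((dif_neg i.2.not_lt).trans (dif_pos i.2))⟩

theorem exists_lowPart_eq_and_blockDual_eq (c : ∀ i : LowIndex A K, A i)
    (x : Dual K (BlockIndex A K → K)) : ∃ P : cart A, lowPart K P = c ∧ blockDual K P = x := by
  obtain ⟨y, rfl⟩ := ((Pi.basisFun K (BlockIndex A K)).constr K).surjective x
  obtain ⟨P, hlow, hblock⟩ := exists_lowPart_eq_and_blockPart_eq K c y
  exact ⟨P, hlow, by rw [blockDual, hblock]⟩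

theorem lowPart_eq_iff {P Q : cart A} :
    lowPart K P = lowPart K Q ↔ ∀ i, A i < K → P.1 i = Q.1 i := by
  simp [funext_iff, lowPart]

theorem lowPart_surjective : Function.Surjective (lowPart K : cart A → ∀ i : LowIndex A K, A i) :=
  fun c => (exists_lowPart_eq_and_blockDual_eq K c 0).imp fun _ h => h.1

end Coordinates

section AffineMaps

theorem apply_eq_iff_of_surjective {X C : Type*} [Finite C] {p : X → C}
    (hp : Function.Surjective p) {σ : X → X} (hσ : Function.Surjective σ)
    (h : ∀ x y, p x = p y → p (σ x) = p (σ y)) {x y : X} : p (σ x) = p (σ y) ↔ p x = p y := by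
  refine ⟨fun hxy => ?_, h x y⟩
  let τ : C → C := fun c => p (σ (hp c).choose)
  have hτ : ∀ z, τ (p z) = p (σ z) := fun z => h _ _ (hp (p z)).choose_spec
  have hτ_surj : Function.Surjective τ := fun c => by
    obtain ⟨z, rfl⟩ := hp c
    obtain ⟨w, rfl⟩ := hσ z
    exact ⟨p w, hτ w⟩
  exact Finite.injective_iff_surjective.2 hτ_surj (by rw [hτ, hτ, hxy])

variable {F : Type*} [Field F] {m : ℕ} {A : Fin m → Subfield F}

section Entries

variable {σ : cart A → cart A} {M : Matrix (Fin m) (Fin m) F} {b : Fin m → F}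

theorem apply_sub_apply (h : ∀ P, (σ P).1 = M.mulVec P.1 + b) (P Q : cart A) (i : Fin m) :
    (σ P).1 i - (σ Q).1 i = ∑ l, M i l * (P.1 l - Q.1 l) := by
  simp [h, Matrix.mulVec, dotProduct, mul_sub]

theorem matrix_entry_mul_mem (h : ∀ P, (σ P).1 = M.mulVec P.1 + b) (i l : Fin m) {a : F}
    (ha : a ∈ A l) : M i l * a ∈ A i := by
  have hsingle : Pi.single l a ∈ cart A := fun i => by
    rcases eq_or_ne i l with rfl | hi
    · simpa using ha
    · simp [hi]
  have hdiff := apply_sub_apply h ⟨_, hsingle⟩ ⟨0, fun i => zero_mem (A i)⟩ i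
  simp only [Pi.zero_apply, sub_zero, Pi.single_apply, mul_ite, mul_zero, Finset.sum_ite_eq',
    Finset.mem_univ, if_true] at hdiff
  exact hdiff ▸ sub_mem ((σ _).2 i) ((σ _).2 i)

theorem matrix_entry_mem (h : ∀ P, (σ P).1 = M.mulVec P.1 + b) (i l : Fin m) : M i l ∈ A i := by
  simpa using matrix_entry_mul_mem h i l (one_mem (A l))

theorem matrix_entry_eq_zero (h : ∀ P, (σ P).1 = M.mulVec P.1 + b) {i l : Fin m}
    (hil : ¬A l ≤ A i) : M i l = 0 := by
  by_contra hM
  refine hil fun a ha => ?_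
  have hquot := mul_mem (inv_mem (matrix_entry_mem h i l)) (matrix_entry_mul_mem h i l ha)
  rwa [inv_mul_cancel_left₀ hM] at hquot

theorem lowPart_apply_eq_iff [Finite F] (hσ : Function.Surjective σ)
    (h : ∀ P, (σ P).1 = M.mulVec P.1 + b) (K : Subfield F) {P Q : cart A} :
    lowPart K (σ P) = lowPart K (σ Q) ↔ lowPart K P = lowPart K Q := by
  -- `σ` induces a surjection of the finite set of low parts, which is therefore injective.
  refine apply_eq_iff_of_surjective (lowPart_surjective K) hσ fun P Q hPQ => ?_
  rw [lowPart_eq_iff] at hPQ ⊢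
  intro i hi
  rw [← sub_eq_zero, apply_sub_apply h]
  refine Finset.sum_eq_zero fun l _ => ?_
  by_cases hl : A l < K
  · rw [hPQ l hl, sub_self, mul_zero]
  · rw [matrix_entry_eq_zero h fun hle => hl (hle.trans_lt hi), zero_mul]

theorem apply_sub_apply_of_lowPart_eq {K : Subfield F} [Fintype (BlockIndex A K)]
    (h : ∀ P, (σ P).1 = M.mulVec P.1 + b) {P Q : cart A} (hPQ : lowPart K P = lowPart K Q)
    {i : Fin m} (hi : A i = K) :
    (σ P).1 i - (σ Q).1 i = ∑ l : BlockIndex A K, M i l * (P.1 l - Q.1 l) := by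
  classical
  rw [lowPart_eq_iff] at hPQ
  rw [apply_sub_apply h, ← Finset.sum_subtype {l | A l = K} (by simp)
    fun l => M i l * (P.1 l - Q.1 l)]
  refine (Finset.sum_filter_of_ne fun l _ hl => ?_).symm
  by_contra hlK
  rcases em (A l ≤ K) with hle | hle
  · exact hl (by rw [hPQ l (hle.lt_of_ne hlK), sub_self, mul_zero])
  · exact hl (by rw [matrix_entry_eq_zero h (hi ▸ hle), zero_mul])

end Entries

/-- On the points with the same low coordinates as `P₀`, which are exactly those sent by `σ` to
points with vanishing low coordinates, the map `σ` acts on the block of `K` as the affine map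
sending `P₀` to `0` whose linear part has the rows `φ`. -/
structure ActsOnBlock (K : Subfield F) (σ : cart A → cart A) (P₀ : cart A)
    (φ : BlockIndex A K → BlockIndex A K → K) : Prop where
  lowPart_eq_zero_iff : ∀ P, lowPart K (σ P) = 0 ↔ lowPart K P = lowPart K P₀
  blockPart_eq : ∀ P, lowPart K P = lowPart K P₀ →
    ∀ i, blockPart K (σ P) i = (blockDual K P - blockDual K P₀) (φ i)

theorem exists_actsOnBlock_of_mem_affGroup [Finite F] (K : Subfield F) {σ : cart A → cart A}
    (hσ : σ ∈ affGroup A) : ∃ P₀ φ, LinearIndependent K φ ∧ ActsOnBlock K σ P₀ φ := by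
  classical
  obtain ⟨hsurj, M, b, h⟩ := hσ
  obtain ⟨P₀, hP₀⟩ := hsurj ⟨0, fun i => zero_mem (A i)⟩
  let φ : BlockIndex A K → BlockIndex A K → K := fun i l =>
    ⟨M.1 i l, i.2.le (matrix_entry_mem h i l)⟩
  have hact : ActsOnBlock K σ P₀ φ := by
    have hzero : lowPart K (σ P₀) = 0 := by rw [hP₀]; rfl
    refine ⟨fun P => by rw [← hzero]; exact lowPart_apply_eq_iff hsurj h K, fun P hP i => ?_⟩
    refine Subtype.ext ?_
    have := apply_sub_apply_of_lowPart_eq h hP i.2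
    simpa [hP₀, blockPart, coe_blockDual_apply, φ, mul_sub] using this
  refine ⟨P₀, φ, linearIndependent_of_forall_exists_dual fun t => ?_, hact⟩
  obtain ⟨Q, hQ, rfl⟩ := exists_lowPart_eq_and_blockPart_eq K 0 t
  obtain ⟨P, rfl⟩ := hsurj Q
  exact ⟨blockDual K P - blockDual K P₀, fun i =>
    (hact.blockPart_eq P ((hact.lowPart_eq_zero_iff P).1 hQ) i).symm⟩

section ExtendByOne

open Matrix

variable {n R : Type*} [Fintype n] [DecidableEq n] [CommRing R] {p : n → Prop} [DecidablePred p]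

/-- The square matrix with the block `N` on the indices satisfying `p` that acts as the identity on
the remaining indices. -/
def extendByOne (N : Matrix {i // p i} {i // p i} R) : Matrix n n R :=
  (fromBlocks N 0 0 1).reindex (Equiv.sumCompl p) (Equiv.sumCompl p)

theorem isUnit_extendByOne {N : Matrix {i // p i} {i // p i} R} (hN : IsUnit N) :
    IsUnit (extendByOne N) := by
  rw [isUnit_iff_isUnit_det] at hN ⊢
  rwa [extendByOne, det_reindex_self, det_fromBlocks_zero₂₁, det_one, mul_one]

theorem extendByOne_mulVec (N : Matrix {i // p i} {i // p i} R) (v : n → R) (i : n) :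
    (extendByOne N *ᵥ v) i = if hi : p i then (N *ᵥ fun l => v l) ⟨i, hi⟩ else v i := by
  rw [extendByOne, reindex_apply, submatrix_mulVec_equiv]
  split_ifs with hi
  · simp only [Function.comp_apply, Equiv.sumCompl_symm_apply_of_pos hi, fromBlocks_mulVec,
      Sum.elim_inl, zero_mulVec, add_zero]
    rfl
  · simp [fromBlocks_mulVec, hi]

end ExtendByOne

theorem exists_mem_affGroup_actsOnBlock [Finite F] {K : Subfield F}
    {φ : BlockIndex A K → BlockIndex A K → K} (hφ : LinearIndependent K φ) (P₀ : cart A) :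
    ∃ σ ∈ affGroup A, ActsOnBlock K σ P₀ φ := by
  classical
  let N : Matrix (BlockIndex A K) (BlockIndex A K) K := Matrix.of φ
  have hN : IsUnit N := Matrix.linearIndependent_rows_iff_isUnit.1 hφ
  obtain ⟨M, hM⟩ := isUnit_extendByOne (hN.map K.subtype.mapMatrix)
  have hblock : ∀ (P : cart A) (i : BlockIndex A K),
      M.1.mulVec (P.1 - P₀.1) i = (blockDual K P - blockDual K P₀) (φ i) := fun P i => by
    rw [hM, extendByOne_mulVec, dif_pos i.2]
    simp [Matrix.mulVec, dotProduct, coe_blockDual_apply, mul_sub, N]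
  have hoff : ∀ (P : cart A) (i : Fin m), A i ≠ K →
      M.1.mulVec (P.1 - P₀.1) i = P.1 i - P₀.1 i := fun P i hi => by
    rw [hM, extendByOne_mulVec, dif_neg hi, Pi.sub_apply]
  have hmem : ∀ P : cart A, M.1.mulVec (P.1 - P₀.1) ∈ cart A := fun P i => by
    by_cases hi : A i = K
    · exact (hblock P ⟨i, hi⟩).symm ▸ hi.ge (Subtype.mem _)
    · exact (hoff P i hi).symm ▸ sub_mem (P.2 i) (P₀.2 i)
  let σ : cart A → cart A := fun P => ⟨_, hmem P⟩
  have hσ : Function.Injective σ := fun P Q h =>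
    Subtype.ext (sub_left_injective
      (Matrix.mulVec_injective_of_isUnit M.isUnit (congrArg Subtype.val h)))
  refine ⟨σ, ⟨Finite.injective_iff_surjective.1 hσ, M, -M.1.mulVec P₀.1, fun P => ?_⟩, ?_⟩
  · rw [← sub_eq_add_neg, ← Matrix.mulVec_sub]
  · refine ⟨fun P => ?_, fun P _ i => Subtype.ext (hblock P i)⟩
    rw [lowPart_eq_iff, funext_iff, Subtype.forall]
    refine forall₂_congr fun i hi => ?_
    rw [← sub_eq_zero (a := P.1 i), ← hoff P i hi.ne]
    exact Subtype.ext_iff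

end AffineMaps

section Words

open Module Submodule

variable {F : Type*} [Field F] {m : ℕ} {A : Fin m → Subfield F}

theorem IsDecomp.not_lt {u ℓ ℓ' : ℕ} {j j' : Fin m} (h : IsDecomp A u j ℓ)
    (h' : IsDecomp A u j' ℓ') : ¬j' < j := fun hlt => by
  have hsub : insert j' (Finset.univ.filter (· < j')) ⊆ Finset.univ.filter (· < j) :=
    Finset.insert_subset (by simpa using hlt)
      (Finset.monotone_filter_right _ fun i _ hi => hi.trans hlt)
  have hle := Finset.sum_le_sum_of_subset (f := fun i => fieldCard A i - 1) hsub
  rw [Finset.sum_insert (by simp)] at hle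
  obtain ⟨hpos, -, hu⟩ := h
  obtain ⟨-, hℓ', hu'⟩ := h'
  omega

theorem IsDecomp.unique {u ℓ ℓ' : ℕ} {j j' : Fin m} (h : IsDecomp A u j ℓ)
    (h' : IsDecomp A u j' ℓ') : j = j' ∧ ℓ = ℓ' := by
  obtain rfl : j = j' := le_antisymm (_root_.not_lt.1 (h.not_lt h')) (_root_.not_lt.1 (h'.not_lt h))
  exact ⟨rfl, Nat.add_left_cancel (h.2.2.symm.trans h'.2.2)⟩

/-- The coordinates of the block of `A j` that `h_k^Ω` forces to vanish. -/
def blockRows (A : Fin m → Subfield F) (j k : Fin m) : Set (BlockIndex A (A j)) :=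
  {i | i.1 ≤ j ∧ i.1 ≠ k}

variable {j k : Fin m}

theorem forall_apply_eq_zero_iff (hA : Monotone A) (hk : A k = A j) (Q : cart A) :
    (∀ i, i ≤ j → i ≠ k → Q.1 i = 0) ↔
      lowPart (A j) Q = 0 ∧ ∀ i ∈ blockRows A j k, blockPart (A j) Q i = 0 := by
  simp only [funext_iff, Subtype.forall, Subtype.ext_iff, lowPart, blockPart, blockRows,
    Set.mem_ofPred_eq, and_imp, Pi.zero_apply, ZeroMemClass.coe_zero]
  refine ⟨fun h => ⟨fun i hi => h i (hA.reflect_lt hi).le ?_, fun i _ => h i⟩,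
    fun h i hij hik => ?_⟩
  · rintro rfl
    exact hi.ne hk
  · exact (hA hij).lt_or_eq.elim (h.1 i) fun hi => h.2 i hi hij hik

/-- The word that vanishes unless the low coordinates are `c`, in which case it is the function `w`
of the coordinates in the block of `K`. -/
noncomputable def cosetWord (K : Subfield F) (c : ∀ i : LowIndex A K, A i)
    (w : Dual K (BlockIndex A K → K) → F) : cart A → F :=
  (lowPart K ⁻¹' {c}).indicator (w ∘ blockDual K)

theorem ActsOnBlock.word_eq [∀ i, Finite (A i)] {σ : cart A → cart A} {P₀ : cart A}
    {φ : BlockIndex A (A j) → BlockIndex A (A j) → A j} (hσ : ActsOnBlock (A j) σ P₀ φ)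
    (hA : Monotone A) (hk : A k = A j) (γ : F) (Ω : Finset (A j)) :
    (fun P => γ * ev A (hPoly A j k (Ω.map (.subtype _))) (σ P)) =
      cosetWord (A j) (lowPart (A j) P₀)
        (flatWord γ (span (A j) (φ '' blockRows A j k)) (blockDual (A j) P₀ ∘ₗ Submodule.subtype _)
          (φ ⟨k, hk⟩) (Ω.map (Equiv.addRight (blockDual (A j) P₀ (φ ⟨k, hk⟩))).toEmbedding)) := by
  classical
  funext P
  rw [ev_hPoly]
  simp only [forall_apply_eq_zero_iff hA hk, hσ.lowPart_eq_zero_iff]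
  by_cases hP : lowPart (A j) P = lowPart (A j) P₀
  swap
  · simp [cosetWord, hP]
  have hflat : (∀ i ∈ blockRows A j k, blockPart (A j) (σ P) i = 0) ↔
      blockDual (A j) P ∘ₗ (span (A j) (φ '' blockRows A j k)).subtype =
        blockDual (A j) P₀ ∘ₗ Submodule.subtype _ := by
    rw [comp_subtype_span_eq_iff, Set.EqOn, Set.forall_mem_image]
    simp [hσ.blockPart_eq P hP, sub_eq_zero]
  have hvalue : (σ P).1 k =
      algebraMap (A j) F ((blockDual (A j) P - blockDual (A j) P₀) (φ ⟨k, hk⟩)) :=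
    congrArg Subtype.val (hσ.blockPart_eq P hP ⟨k, hk⟩)
  have hcoe : ∀ x : A j, (x : F) = algebraMap (A j) F x := fun _ => rfl
  by_cases hPflat : blockDual (A j) P ∘ₗ (span (A j) (φ '' blockRows A j k)).subtype =
        blockDual (A j) P₀ ∘ₗ Submodule.subtype _
  · simp [-Subtype.forall, hflat, hP, hPflat, cosetWord, flatWord, hvalue, hcoe, sub_sub, add_comm]
  · simp [-Subtype.forall, hflat, hP, hPflat, cosetWord, flatWord]

theorem word_mem_image [Finite F] (hA : Monotone A) (hk : A k = A j) {σ : cart A → cart A}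
    (hσ : σ ∈ affGroup A) {γ : F} (hγ : γ ≠ 0) (Ω : Finset (A j)) :
    (fun P => γ * ev A (hPoly A j k (Ω.map (.subtype _))) (σ P)) ∈
      Set.image2 (cosetWord (A j)) Set.univ
        (flatWords F (BlockIndex A (A j) → A j) (blockRows A j k).ncard Ω.card) := by
  obtain ⟨P₀, φ, hφ, hact⟩ := exists_actsOnBlock_of_mem_affGroup (A j) hσ
  refine ⟨_, trivial, _, ⟨γ, hγ, _, _, φ ⟨k, hk⟩, ?_, _, ?_, Finset.card_map _, rfl⟩,
    (hact.word_eq hA hk γ Ω).symm⟩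
  · exact hφ.notMem_span_image (by simp [blockRows])
  · have := Fintype.ofFinite (blockRows A j k)
    have hrows : LinearIndependent (A j) fun i : blockRows A j k => φ i :=
      hφ.comp _ Subtype.val_injective
    rw [Set.image_eq_range, finrank_span_eq_card hrows, ← Nat.card_eq_fintype_card,
      Nat.card_coe_set_eq]

theorem exists_word_eq [Finite F] (hA : Monotone A) (hk : A k = A j) {ℓ : ℕ}
    (c : ∀ i : LowIndex A (A j), A i) {w : Dual (A j) (BlockIndex A (A j) → A j) → F}
    (hw : w ∈ flatWords F (BlockIndex A (A j) → A j) (blockRows A j k).ncard ℓ) :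
    ∃ γ : Fˣ, ∃ σ ∈ affGroup A, ∃ Ω : Finset (A j), Ω.card = ℓ ∧
      cosetWord (A j) c w =
        fun P => γ * ev A (hPoly A j k (Ω.map (.subtype _))) (σ P) := by
  obtain ⟨γ, hγ, U, ξ, f, hf, Ω, hU, hΩ, rfl⟩ := hw
  obtain ⟨φ, rfl, rfl⟩ := exists_basis_span_image_eq (Pi.basisFun (A j) (BlockIndex A (A j)))
    (i := ⟨k, hk⟩) (by simp [blockRows]) hU hf
  obtain ⟨x, rfl⟩ := LinearMap.exists_extend ξ
  obtain ⟨P₀, rfl, rfl⟩ := exists_lowPart_eq_and_blockDual_eq (A j) c x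
  obtain ⟨σ, hσ, hact⟩ := exists_mem_affGroup_actsOnBlock φ.linearIndependent P₀
  let e := Equiv.addRight (blockDual (A j) P₀ (φ ⟨k, hk⟩))
  refine ⟨Units.mk0 γ hγ, σ, hσ, Ω.map e.symm.toEmbedding, (Finset.card_map _).trans hΩ, ?_⟩
  rw [Units.val_mk0, hact.word_eq hA hk, Finset.map_map, ← Equiv.trans_toEmbedding,
    Equiv.symm_trans_self, Equiv.refl_toEmbedding, Finset.map_refl]

theorem words_eq_image [Finite F] (hA : Monotone A) (hk : A k = A j) {u ℓ : ℕ}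
    (hu : IsDecomp A u j ℓ) :
    words A u k = Set.image2 (cosetWord (A j)) Set.univ
      (flatWords F (BlockIndex A (A j) → A j) (blockRows A j k).ncard ℓ) := by
  classical
  have hcard : ∀ n, n + (fieldCard A j - ℓ) = fieldCard A k ↔ n = ℓ := fun n => by
    have hpos : 0 < fieldCard A j := Nat.card_pos
    have hle := hu.2.1
    rw [show fieldCard A k = fieldCard A j by rw [fieldCard, hk, fieldCard]]
    omega
  ext w
  constructor
  · rintro ⟨j', ℓ', hu', Ω, hΩA, hΩ, γ, σ, hσ, rfl⟩
    obtain ⟨rfl, rfl⟩ := hu.unique hu'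
    obtain ⟨Ω, rfl⟩ : ∃ Ω' : Finset (A j), Ω'.map (.subtype _) = Ω :=
      ⟨_, Finset.subtype_map_of_mem fun ω hω => hk.le (hΩA ω hω)⟩
    rw [hcard, Finset.card_map] at hΩ
    exact hΩ ▸ word_mem_image hA hk hσ γ.ne_zero Ω
  · rintro ⟨c, -, w, hw, rfl⟩
    obtain ⟨γ, σ, hσ, Ω, hΩ, h⟩ := exists_word_eq hA hk c hw
    refine ⟨j, ℓ, hu, Ω.map (.subtype _), fun ω hω => ?_, ?_, γ, σ, hσ, h⟩
    · obtain ⟨ω, -, rfl⟩ := Finset.mem_map.1 hω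
      exact hk.ge ω.2
    · rw [hcard, Finset.card_map, hΩ]

theorem prod_fieldCard_eq (hA : Monotone A) (hk : A k = A j) :
    ∏ i : Fin m with i ≤ j ∧ i ≠ k, fieldCard A i =
      Nat.card (∀ i : LowIndex A (A j), A i) * Nat.card (A j) ^ (blockRows A j k).ncard := by
  classical
  have hlow : ({i | i ≤ j ∧ i ≠ k} : Finset (Fin m)).filter (A · < A j) =
      Finset.univ.filter (A · < A j) := by
    ext i
    simp only [Finset.mem_filter, Finset.mem_univ, true_and, and_iff_right_iff_imp]
    exact fun hi => ⟨(hA.reflect_lt hi).le, by rintro rfl; exact hi.ne hk⟩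
  have hblock : (({i | i ≤ j ∧ i ≠ k} : Finset (Fin m)).filter (¬A · < A j) : Set (Fin m)) =
      Subtype.val '' blockRows A j k := by
    ext i
    have hi : i ≤ j → (¬A i < A j ↔ A i = A j) := fun h => by simp [(hA h).lt_iff_ne]
    simp only [Finset.coe_filter, Finset.mem_filter, Finset.mem_univ, true_and, Set.mem_ofPred_eq,
      blockRows, Set.mem_image, Subtype.exists, exists_and_left, exists_prop, exists_eq_right_right]
    tauto
  have hcard : ∀ i ∈ ({i | i ≤ j ∧ i ≠ k} : Finset (Fin m)).filter (¬A · < A j),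
      fieldCard A i = Nat.card (A j) := fun i hi => by
    obtain ⟨i, -, rfl⟩ := hblock.subset hi
    rw [fieldCard, i.2]
  rw [← Finset.prod_filter_mul_prod_filter_not _ (A · < A j), hlow, Finset.prod_congr rfl hcard,
    Finset.prod_const, ← Set.ncard_coe_finset, hblock,
    Set.ncard_image_of_injective _ Subtype.val_injective, Nat.card_pi]
  exact congrArg (· * _) (Finset.prod_subtype {i | A i < A j} (by simp) _)

theorem ncard_words [Finite F] (hA : Monotone A) (hk : A k = A j) {u ℓ : ℕ}
    (hu : IsDecomp A u j ℓ) (hℓ : ℓ + 2 ≤ fieldCard A j) :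
    (words A u k).ncard =
      (Nat.card F - 1) * (∏ i : Fin m with i ≤ j ∧ i ≠ k, fieldCard A i) *
        gaussBinom (A j) (Nat.card (BlockIndex A (A j))) (blockRows A j k).ncard *
        gaussBinom (A j) (Nat.card (BlockIndex A (A j)) - (blockRows A j k).ncard) 1 *
        (fieldCard A j).choose ℓ := by
  classical
  have hsurj : Function.Surjective fun P : cart A => (lowPart (A j) P, blockDual (A j) P) :=
    fun cx => (exists_lowPart_eq_and_blockDual_eq (A j) cx.1 cx.2).imp fun _ h => Prod.ext h.1 h.2
  have hinj : Set.InjOn (Function.uncurry (cosetWord (A j))) (Set.univ ×ˢ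
      flatWords F (BlockIndex A (A j) → A j) (blockRows A j k).ncard ℓ) :=
    injOn_indicator_preimage hsurj <| zero_notMem_flatWords fun Ω hΩ =>
      (compl_nontrivial_of_card_add_two_le (hΩ ▸ hℓ)).nonempty
  rw [words_eq_image hA hk hu, ← Set.image_uncurry_prod, hinj.ncard_image, Set.ncard_prod,
    Set.ncard_univ, ncard_flatWords hu.1 hℓ, prod_fieldCard_eq hA hk,
    Module.finrank_fintype_fun_eq_card, Nat.card_eq_fintype_card (α := BlockIndex A (A j)),
    fieldCard]
  ring

end Words

section Blocks

variable {lam : ℕ} (μ : Fin lam → ℕ)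

theorem blockSum_mono : Monotone (blockSum μ) := fun _ _ h =>
  Finset.sum_le_sum_of_subset <| Finset.monotone_filter_right _ fun _ _ hi => hi.trans_le h

theorem blockSum_succ (t : Fin lam) : blockSum μ (t.val + 1) = blockSum μ t.val + μ t := by
  have hfilter : (Finset.univ.filter fun i : Fin lam => i.val < t.val + 1) =
      insert t (Finset.univ.filter fun i => i.val < t.val) := by
    ext i
    simp only [Finset.mem_filter, Finset.mem_univ, true_and, Finset.mem_insert, Fin.ext_iff]
    omega
  rw [blockSum, hfilter, Finset.sum_insert (by simp), add_comm, blockSum]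

theorem blockSum_eq_sum : blockSum μ lam = ∑ t, μ t := by
  simp [blockSum]

variable {μ}

theorem InBlock.le {t t' : Fin lam} {i i' : ℕ} (h : InBlock μ t i) (h' : InBlock μ t' i')
    (hi : i ≤ i') : t ≤ t' := by
  by_contra! hlt
  exact (h'.2.trans_le ((blockSum_mono μ (Nat.succ_le_of_lt hlt)).trans h.1)).not_ge hi

theorem exists_inBlock {i : ℕ} (hi : i < ∑ t, μ t) : ∃ t, InBlock μ t i := by
  rw [← blockSum_eq_sum] at hi
  have hex : ∃ n, i < blockSum μ n := ⟨lam, hi⟩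
  obtain ⟨t, ht⟩ : ∃ t, Nat.find hex = t + 1 :=
    Nat.exists_eq_succ_of_ne_zero fun h => by
      have hlt := Nat.find_spec hex
      rw [h] at hlt
      simp [blockSum] at hlt
  have htlam : t < lam := Nat.lt_of_succ_le (ht.ge.trans (Nat.find_min' hex hi))
  exact ⟨⟨t, htlam⟩, not_lt.1 (Nat.find_min hex (ht ▸ t.lt_succ_self)), ht ▸ Nat.find_spec hex⟩

variable {F : Type*} [Field F] {E : Fin lam → Subfield F} {m : ℕ} {A : Fin m → Subfield F}

theorem monotone_of_forall_inBlock (hE : Monotone E) (hm : ∑ t, μ t = m)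
    (hA : ∀ (t : Fin lam) (i : Fin m), InBlock μ t i.val → A i = E t) : Monotone A := by
  intro i i' hi
  obtain ⟨t, ht⟩ := exists_inBlock (i.2.trans_eq hm.symm)
  obtain ⟨t', ht'⟩ := exists_inBlock (i'.2.trans_eq hm.symm)
  rw [hA t i ht, hA t' i' ht']
  exact hE (ht.le ht' hi)

theorem eq_iff_inBlock (hE : Function.Injective E) (hm : ∑ t, μ t = m)
    (hA : ∀ (t : Fin lam) (i : Fin m), InBlock μ t i.val → A i = E t) {t : Fin lam} {i : Fin m} :
    A i = E t ↔ InBlock μ t i.val := by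
  refine ⟨fun h => ?_, hA t i⟩
  obtain ⟨t', ht'⟩ := exists_inBlock (i.2.trans_eq hm.symm)
  rwa [← hE ((hA t' i ht').symm.trans h)]

variable {j k : Fin m} {s e : ℕ}

theorem natCard_blockIndex (hblock : ∀ i : Fin m, A i = A j ↔ s ≤ i.val ∧ i.val < e)
    (he : e ≤ m) : Nat.card (BlockIndex A (A j)) = e - s := by
  have himage : Fin.val '' {i | A i = A j} = Set.Ico s e := by
    ext n
    simp only [hblock, Set.mem_image, Set.mem_ofPred_eq, Set.mem_Ico]
    exact ⟨by rintro ⟨i, hi, rfl⟩; exact hi, fun hn => ⟨⟨n, hn.2.trans_le he⟩, hn, rfl⟩⟩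
  rw [← Set.ncard_Ico_nat, ← himage, Set.ncard_image_of_injective _ Fin.val_injective]
  exact Nat.card_coe_set_eq {i | A i = A j}

theorem ncard_blockRows (hblock : ∀ i : Fin m, A i = A j ↔ s ≤ i.val ∧ i.val < e)
    (hk : A k = A j) (hkj : k ≤ j) : (blockRows A j k).ncard = j.val - s := by
  have hj := (hblock j).1 rfl
  have hsk := ((hblock k).1 hk).1
  have himage : (fun i : BlockIndex A (A j) => i.1.val) '' blockRows A j k =
      Set.Icc s j \ {k.val} := by
    ext n
    simp only [blockRows, Set.mem_image, Set.mem_ofPred_eq, Subtype.exists, hblock, Set.mem_sdiff,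
      Set.mem_Icc, Set.mem_singleton_iff, Fin.le_def, ne_eq, Fin.ext_iff, exists_and_left]
    constructor
    · rintro ⟨i, ⟨hij, hik⟩, hi, rfl⟩
      exact ⟨⟨hi.1, hij⟩, hik⟩
    · rintro ⟨hn, hnk⟩
      exact ⟨⟨n, hn.2.trans_lt j.2⟩, ⟨hn.2, hnk⟩, ⟨hn.1, hn.2.trans_lt hj.2⟩, rfl⟩
  rw [← Set.ncard_image_of_injective _ (Fin.val_injective.comp Subtype.val_injective)]
  refine (congrArg Set.ncard himage).trans ?_
  rw [Set.ncard_sdiff_singleton_of_mem (Set.mem_Icc.2 ⟨hsk, hkj⟩), Set.ncard_Icc_nat]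
  omega

end Blocks

end NestedCartesian

theorem mainTheorem3 {F : Type*} [Field F] [Finite F]
    -- the distinct nested subfields and their multiplicities
    {lam : ℕ} (E : Fin lam → Subfield F) (hE : StrictMono E)
    (μ : Fin lam → ℕ) (hμ : ∀ t, 0 < μ t)
    -- `𝒜 = A_1 × ⋯ × A_m`, where each `F_t` is repeated `μ_t` times
    {m : ℕ} (hm : ∑ t, μ t = m) (A : Fin m → Subfield F)
    (hA : ∀ (t : Fin lam) (i : Fin m), NestedCartesian.InBlock μ t i.val → A i = E t)
    -- `u = ∑_{i=1}^{j} (d_i - 1) + ℓ` with `0 ≤ j < m` and `0 < ℓ < d_{j+1} - 1`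
    (u ℓ : ℕ) (j : Fin m) (hℓ : 0 < ℓ) (hℓ' : ℓ < NestedCartesian.fieldCard A j - 1)
    (hu : u = (∑ i : Fin m with i < j, (NestedCartesian.fieldCard A i - 1)) + ℓ)
    -- `r = t_{j+1}`, `1 ≤ k ≤ j + 1` and `t_k = r`
    (r : Fin lam) (hr : NestedCartesian.InBlock μ r j.val)
    (k : Fin m) (hkj : k ≤ j) (hk : NestedCartesian.InBlock μ r k.val) :
    (NestedCartesian.words A u k).ncard =
      (Nat.card F - 1) *
        (∏ i : Fin m with i ≤ j ∧ i ≠ k, NestedCartesian.fieldCard A i) *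
        NestedCartesian.gaussBinom (A j) (μ r) (j.val - NestedCartesian.blockSum μ r.val) *
        NestedCartesian.gaussBinom (A k) (NestedCartesian.blockSum μ (r.val + 1) - j.val) 1 *
        (NestedCartesian.fieldCard A k).choose (NestedCartesian.fieldCard A j - ℓ) := by
  open NestedCartesian in
  have hblock (i : Fin m) : A i = A j ↔ InBlock μ r i := by
    rw [hA r j hr, eq_iff_inBlock hE.injective hm hA]
  have hAk : A k = A j := (hblock k).2 hk
  have hsucc := blockSum_succ μ r
  have hle : blockSum μ (r.val + 1) ≤ m :=
    (blockSum_mono μ r.2).trans_eq ((blockSum_eq_sum μ).trans hm)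
  have hsub : μ r - (j.val - blockSum μ r) = blockSum μ (r.val + 1) - j.val := by
    have := hr.1
    omega
  rw [ncard_words (monotone_of_forall_inBlock hE.monotone hm hA) hAk ⟨hℓ, hℓ'.le, hu⟩ (by omega),
    natCard_blockIndex hblock hle, ncard_blockRows hblock hAk hkj,
    show blockSum μ (r.val + 1) - blockSum μ r = μ r by omega, hsub, hAk,
    show fieldCard A k = fieldCard A j by rw [fieldCard, hAk, fieldCard],
    Nat.choose_symm (by omega)]
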